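/- Let $p$ be a prime, let $\zeta$ be a primitive $p$-th root of unity, and let $a,b,c\ge 0$ be integers. Let $L$ be a $\mathbb Z[\mathbb Z/p]$-module of type $(a,b,c)$, that is, isomorphic as a $\mathbb Z/p$-module to $$\Big(\bigoplus_{i=1}^a B_i\Big)\oplus\Big(\bigoplus_{j=1}^b (C_j\oplus\mathbb Z)\Big)\oplus\mathbb Z^c,$$ where the $B_i$ and $C_j$ are nonzero fractional ideals of $\mathbb Q(\zeta)$ (with respect to $\mathbb Z[\zeta]$), and a fixed generator $t$ of $\mathbb Z/p$ acts on $B_i$ as multiplication by $\zeta$, on $C_j\oplus\mathbb Z$ by $t\cdot(x,m)=(\zeta x+m u_j,m)$ for some $u_j\in C_j\setminus(1-\zeta)C_j$, and trivially on $\mathbb Z^c$. Let $\Gamma=L\rtimes\mathbb Z/p$. Then the following hold. 1. If $p$ is odd, then every virtually cyclic subgroup of $\Gamma$ is isomorphic to one of $1$, $\mathbb Z/p$, $\mathbb Z$, $\mathbb Z\times\mathbb Z/p$. 2. Let $\mathcal P$ be the set of conjugacy classes of maximal finite subgroups of $\Gamma$. For every $1$-cocycle $f:\mathbb Z/p\to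 L$ the subgroup $\{(f(g),g) : g\in\mathbb Z/p\}$ of $\Gamma$ is maximal finite, and sending the class of $f$ to the conjugacy class of this subgroup is a well-defined bijection $H^1(\mathbb Z/p;L)\to\mathcal P$. Moreover $H^1(\mathbb Z/p;L)\cong(\mathbb Z/p)^a$, and $|\mathcal P|=p^a$. 3. If $P\le\Gamma$ is a subgroup of order $p$, then its normalizer satisfies $N_\Gamma P\cong\mathbb Z^{b+c}\times P$, and its Weyl group satisfies $W_\Gamma P:=N_\Gamma P/P\cong\mathbb Z^{b+c}$. -/

import Mathlib

open scoped NumberField nonZeroDivisors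

/-- A group is virtually cyclic if it has a cyclic subgroup of finite index. -/
def IsVirtuallyCyclic (G : Type*) [Group G] : Prop :=
  ∃ H : Subgroup G, IsCyclic H ∧ H.FiniteIndex

/-- A maximal finite subgroup: a finite subgroup that is not properly contained in any finite
subgroup. -/
def IsMaximalFinite {G : Type*} [Group G] (H : Subgroup G) : Prop :=
  Maximal (fun K : Subgroup G => Finite K) H

/-- Conjugacy as an equivalence relation on the set of maximal finite subgroups of `G`. -/
def maximalFiniteSetoid (G : Type*) [Group G] :
    Setoid {H : Subgroup G // IsMaximalFinite H} where
  r H K := ∃ g : G, K.1 = H.1.map (MulAut.conj g).toMonoidHom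
  iseqv :=
    { refl := fun H => ⟨1, by ext x; simp⟩
      symm := by
        rintro ⟨H, hH⟩ ⟨K, hK⟩ ⟨g, rfl⟩
        exact ⟨g⁻¹, by ext x; simp [Subgroup.mem_map, mul_assoc]⟩
      trans := by
        rintro ⟨H, hH⟩ ⟨K, hK⟩ ⟨M, hM⟩ ⟨g, rfl⟩ ⟨h, rfl⟩
        exact ⟨h * g, by ext x; simp [Subgroup.mem_map, mul_assoc]⟩ }

/-- The set of conjugacy classes of maximal finite subgroups of `G`. -/
def MaximalFiniteClasses (G : Type*) [Group G] : Type _ :=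
  Quotient (maximalFiniteSetoid G)

section SemidirectProduct

variable {G L : Type*} [Group G] [AddCommGroup L]

/-- An integral representation of `G` on `L`, as an action of `G` on the group `L` (written
multiplicatively) by automorphisms. -/
def Representation.toMulAutHom (ρ : Representation ℤ G L) : G →* MulAut (Multiplicative L) where
  toFun g := AddEquiv.toMultiplicative
    { toFun := ρ g
      invFun := ρ g⁻¹
      left_inv := fun x => by simp
      right_inv := fun x => by simp
      map_add' := fun x y => map_add (ρ g) x y }
  map_one' := by ext x; simp
  map_mul' g h := by ext x; simp

/-- The semidirect product `L ⋊ G` determined by an integral representation of `G` on `L`. -/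
abbrev Representation.SemidirectGroup (ρ : Representation ℤ G L) : Type _ :=
  Multiplicative L ⋊[ρ.toMulAutHom] G

end SemidirectProduct

/-- For a `1`-cocycle `f : G → L`, the subgroup `{(f g, g) | g ∈ G}` of `L ⋊ G`. -/
def cocycleSubgroup {G L : Type} [Group G] [AddCommGroup L] (ρ : Representation ℤ G L)
    (f : groupCohomology.cocycles₁ (Rep.of ρ)) : Subgroup ρ.SemidirectGroup where
  carrier := {γ | γ.left = Multiplicative.ofAdd (f γ.right : L)}
  one_mem' := by
    have h : f 1 = 0 := groupCohomology.cocycles₁_map_one f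
    change (1 : Multiplicative L) = Multiplicative.ofAdd (f 1 : L)
    rw [h]; rfl
  mul_mem' := by
    intro x y hx hy
    have h := (groupCohomology.mem_cocycles₁_iff f.1).1 f.2 x.right y.right
    change x.left * ρ.toMulAutHom x.right y.left = Multiplicative.ofAdd (f (x.right * y.right) : L)
    rw [Set.mem_ofPred_eq] at hx hy
    rw [hx, hy]
    exact (congrArg Multiplicative.ofAdd (h.trans (add_comm _ _))).symm
  inv_mem' := by
    intro x hx
    have h := (groupCohomology.mem_cocycles₁_iff f.1).1 f.2 x.right⁻¹ x.right
    rw [inv_mul_cancel] at h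
    have h1 : f.1 1 = 0 := groupCohomology.cocycles₁_map_one f
    rw [h1] at h
    rw [Set.mem_ofPred_eq] at hx
    change ρ.toMulAutHom x.right⁻¹ x.left⁻¹ = Multiplicative.ofAdd (f x.right⁻¹ : L)
    rw [hx, map_inv]
    exact congrArg Multiplicative.ofAdd (neg_eq_of_add_eq_zero_right h.symm)

/-- The `ℤ/p`-module `L` (given by `ρ`) is of type `(a, b, c)`: it is isomorphic to
`(⨁_{i < a} B i) ⊕ (⨁_{j < b} (C j ⊕ ℤ)) ⊕ ℤ ^ c`, where the `B i` and `C j` are nonzero fractional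
ideals of `ℚ(ζ)`, the generator `t = 1` of `ℤ/p` acts on `B i` as multiplication by `ζ`, on
`C j ⊕ ℤ` by `t (x, m) = (ζ x + m u_j, m)` with `u_j ∈ C j`, `u_j ∉ (1 - ζ) C j`, and trivially on
`ℤ ^ c`.  As `t` generates `ℤ/p`, an additive isomorphism that is compatible with the action of `t`
is an isomorphism of `ℤ/p`-modules. -/
def IsOfType {p : ℕ} {K : Type*} [Field K] [NumberField K] (ζ : 𝓞 K) (a b c : ℕ)
    {L : Type*} [AddCommGroup L] (ρ : Representation ℤ (Multiplicative (ZMod p)) L) : Prop :=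
  ∃ (B : Fin a → FractionalIdeal (𝓞 K)⁰ K) (C : Fin b → FractionalIdeal (𝓞 K)⁰ K)
    (u : ∀ j, ↥(C j : Submodule (𝓞 K) K)),
    (∀ i, B i ≠ 0) ∧ (∀ j, C j ≠ 0) ∧
    (∀ j, ∀ x : ↥(C j : Submodule (𝓞 K) K), u j ≠ (1 - ζ) • x) ∧
    ∃ e : L ≃+ (∀ i, ↥(B i : Submodule (𝓞 K) K)) ×
        (∀ j, ↥(C j : Submodule (𝓞 K) K) × ℤ) × (Fin c → ℤ),
      ∀ x : L, e (ρ (Multiplicative.ofAdd 1) x) =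
        (fun i => ζ • (e x).1 i,
          fun j => (ζ • ((e x).2.1 j).1 + ((e x).2.1 j).2 • u j, ((e x).2.1 j).2),
          (e x).2.2)

/-! Since `L` is torsion-free, a finite subgroup of `L ⋊ G` meets `L` trivially and so embeds in
`G`. For `G` of prime order, every maximal finite subgroup is therefore a complement of `L`, that
is, the graph of a cocycle (`exists_eq_cocycleSubgroup`), and conjugating by `L` changes the cocycle
by a coboundary (`H1π_eq_iff_exists_conj`). Such a complement `P` has normalizer `L^G × P`.

What remains is to compute `H¹` and `L^G` when `t` generates `G`. A cocycle is determined by its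
value at `t`. On an ideal, the norm `∑ ζ ^ k` vanishes, so every value is allowed, and coboundaries
fill `(1 - ζ) B`, of index `p`: each `B i` contributes `ℤ/p` to `H¹` and nothing to the invariants.
In `C j ⊕ ℤ` the class of `u j` spans `C j / (1 - ζ) C j`, which kills `H¹` and leaves invariants of
rank one (`nonempty_H1_equiv`, `nonempty_invariants_equiv`).

For odd `p`, a virtually cyclic subgroup meets `L` in a cyclic group, on which an element of odd
order cannot act by `-1`; the subgroup is thus abelian, and it splits if it has torsion. -/

/-! ### Ideals modulo `1 - ζ` -/

/-- Multiplication by `x` on a nonzero ideal has index `N(x)`. -/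
theorem Ideal.index_range_lsmul {S : Type*} [CommRing S] [IsDedekindDomain S] [Module.Free ℤ S]
    [Module.Finite ℤ S] (x : S) {I : Ideal S} (hI : I ≠ ⊥) :
    (LinearMap.range (LinearMap.lsmul S I x)).toAddSubgroup.index =
      Ideal.absNorm (Ideal.span {x}) := by
  have h1 : (LinearMap.range (LinearMap.lsmul S I x)).toAddSubgroup =
      (Ideal.span {x} * I).toAddSubgroup.addSubgroupOf I.toAddSubgroup := by
    ext y
    rw [AddSubgroup.mem_addSubgroupOf, Submodule.mem_toAddSubgroup, Submodule.mem_toAddSubgroup,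
      LinearMap.mem_range]
    refine Iff.trans ?_ Ideal.mem_span_singleton_mul.symm
    constructor
    · rintro ⟨z, rfl⟩
      exact ⟨z, z.2, rfl⟩
    · rintro ⟨z, hz, h⟩
      exact ⟨⟨z, hz⟩, Subtype.ext h⟩
  have h2 : (Ideal.span {x} * I).toAddSubgroup.relIndex I.toAddSubgroup * I.toAddSubgroup.index =
      (Ideal.span {x} * I).toAddSubgroup.index :=
    AddSubgroup.relIndex_mul_index (Ideal.mul_le_right : Ideal.span {x} * I ≤ I)
  have h3 : ∀ J : Ideal S, J.toAddSubgroup.index = Ideal.absNorm J := fun J => rfl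
  rw [h3, h3, map_mul] at h2
  rw [h1]
  exact Nat.eq_of_mul_eq_mul_right
    (Nat.pos_of_ne_zero (fun h => hI (Ideal.absNorm_eq_zero_iff.1 h))) h2

theorem IsPrimitiveRoot.absNorm_span_one_sub {p : ℕ} (hp : p.Prime) {K : Type*} [Field K]
    [NumberField K] [IsCyclotomicExtension {p} ℚ K] {ζ : 𝓞 K} (hζ : IsPrimitiveRoot ζ p) :
    Ideal.absNorm (Ideal.span {1 - ζ}) = p := by
  have : Fact p.Prime := ⟨hp⟩
  have h1 : IsPrimitiveRoot (ζ : K) (p ^ (0 + 1)) := by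
    simpa using hζ.map_of_injective (f := algebraMap (𝓞 K) K) (FaithfulSMul.algebraMap_injective (𝓞 K) K)
  have : IsCyclotomicExtension {p ^ (0 + 1)} ℚ K := by simpa
  have h2 := IsCyclotomicExtension.Rat.absNorm_span_zeta_sub_one p 0 h1
  rw [← neg_sub, Ideal.span_singleton_neg]
  exact h2

/-- Since `∑ ζ ^ k = 0`, the integer `p` equals `∑ (1 - ζ ^ k)`, and `1 - ζ` divides each term. -/
theorem IsPrimitiveRoot.one_sub_dvd_natCast {R : Type*} [CommRing R] [IsDomain R] {p : ℕ}
    (hp : 1 < p) {ζ : R} (hζ : IsPrimitiveRoot ζ p) : 1 - ζ ∣ (p : R) := by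
  have h : (p : R) = ∑ k ∈ Finset.range p, (1 - ζ ^ k) := by
    rw [Finset.sum_sub_distrib, hζ.geom_sum_eq_zero hp]
    simp
  rw [h]
  refine Finset.dvd_sum fun k _ => ?_
  simpa using sub_dvd_pow_sub_pow 1 ζ k

/-- Clearing denominators turns `C` into an integral ideal, where multiplication by `1 - ζ` has
index `N(1 - ζ) = p`; a group of order `p` is `ℤ/p`. The map `q` makes divisibility by `1 - ζ` a
test in a field. -/
theorem FractionalIdeal.exists_addMonoidHom_zmod {p : ℕ} (hp : p.Prime) {K : Type*} [Field K]
    [NumberField K] [IsCyclotomicExtension {p} ℚ K] {ζ : 𝓞 K} (hζ : IsPrimitiveRoot ζ p)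
    (C : FractionalIdeal (𝓞 K)⁰ K) (hC : C ≠ 0) :
    ∃ q : ↥(C : Submodule (𝓞 K) K) →+ ZMod p, Function.Surjective q ∧
      ∀ x, q x = 0 ↔ ∃ y : ↥(C : Submodule (𝓞 K) K), x = (1 - ζ) • y := by
  have : Fact p.Prime := ⟨hp⟩
  let e : ↥(C : Submodule (𝓞 K) K) ≃ₗ[𝓞 K] C.num :=
    C.equivNum (nonZeroDivisors.coe_ne_zero _)
  have hI : C.num ≠ ⊥ := fun h => hC (C.num_eq_zero_iff.1 h)
  let N := (LinearMap.range (LinearMap.lsmul (𝓞 K) C.num (1 - ζ))).toAddSubgroup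
  have hN : N.index = p := by
    rw [Ideal.index_range_lsmul _ hI, hζ.absNorm_span_one_sub hp]
  let E : C.num ⧸ N ≃+ ZMod p := addEquivOfPrimeCardEq (p := p) hN (Nat.card_zmod p)
  refine ⟨(E.toAddMonoidHom.comp (QuotientAddGroup.mk' N)).comp e.toLinearMap.toAddMonoidHom,
    (E.surjective.comp (QuotientAddGroup.mk'_surjective N)).comp e.surjective, fun x => ?_⟩
  have : E (QuotientAddGroup.mk' N (e x)) = 0 ↔ e x ∈ N := by
    rw [EmbeddingLike.map_eq_zero_iff, ← AddMonoidHom.mem_ker, QuotientAddGroup.ker_mk']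
  refine this.trans ?_
  constructor
  · rintro ⟨z, hz⟩
    refine ⟨e.symm z, e.injective ?_⟩
    rw [map_smul, e.apply_symm_apply]
    exact hz.symm
  · rintro ⟨y, rfl⟩
    exact ⟨e y, (map_smul e _ _).symm⟩

/-! ### Virtually cyclic groups -/

theorem IsVirtuallyCyclic.subgroup {G : Type*} [Group G] (h : IsVirtuallyCyclic G)
    (A : Subgroup G) : IsVirtuallyCyclic A := by
  obtain ⟨H, hH, hfin⟩ := h
  refine ⟨H.subgroupOf A, ?_, inferInstance⟩
  exact isCyclic_of_injective (G' := H) ((A.subtype.comp (H.subgroupOf A).subtype).codRestrict H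
    fun x => x.2) fun x y hxy =>
      Subtype.ext (Subtype.ext (congrArg (fun z : H => (z : G)) hxy))

/-- A torsion-free commutative virtually cyclic group is cyclic. -/
theorem IsVirtuallyCyclic.isCyclic {A : Type*} [CommGroup A]
    (htf : ∀ (x : A) (n : ℕ), n ≠ 0 → x ^ n = 1 → x = 1) (h : IsVirtuallyCyclic A) :
    IsCyclic A := by
  obtain ⟨H, hH, hfin⟩ := h
  -- Raising to the power `H.index` embeds `A` in `H`, by torsion-freeness.
  refine isCyclic_of_injective (G' := H)
    ((powMonoidHom H.index).codRestrict H fun x => H.pow_index_mem x) ?_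
  rw [injective_iff_map_eq_one]
  intro x hx
  exact htf x _ hfin.index_ne_zero (congrArg Subtype.val hx)

theorem nonempty_mulEquiv_unit_or_int {A : Type*} [Group A] (hA : IsCyclic A)
    (htf : ∀ (x : A) (n : ℕ), n ≠ 0 → x ^ n = 1 → x = 1) :
    Nonempty (A ≃* Unit) ∨ Nonempty (A ≃* Multiplicative ℤ) := by
  rcases finite_or_infinite A with hfin | hinf
  · have : Subsingleton A :=
      subsingleton_of_forall_eq 1 fun x => htf x _ Nat.card_pos.ne' pow_card_eq_one'
    have : Unique A := ⟨⟨1⟩, fun x => Subsingleton.elim _ _⟩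
    exact .inl ⟨MulEquiv.ofUnique⟩
  · refine .inr ⟨mulEquivOfCyclicCardEq ?_⟩
    rw [Nat.card_eq_zero_of_infinite, Nat.card_eq_zero_of_infinite]

/-- A cyclic torsion-free kernel of a homomorphism to a group of odd order `p` is central. -/
theorem MonoidHom.ker_le_center_of_isCyclic {G Q : Type*} [Group G] [Group Q] {p : ℕ}
    (hp : Odd p) (hQ : Nat.card Q = p) (f : G →* Q) [IsCyclic f.ker]
    (htf : ∀ (x : f.ker) (n : ℕ), n ≠ 0 → x ^ n = 1 → x = 1) :
    f.ker ≤ Subgroup.center G := by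
  obtain ⟨a, ha⟩ := IsCyclic.exists_generator (α := f.ker)
  -- Conjugation by `v` sends `a` to some `a ^ k`. As `v ^ p` lies in the kernel, it commutes with
  -- `a`, so `k ^ p = 1` unless `a = 1`; oddness of `p` excludes `k = -1`.
  have key : ∀ v : G, MulAut.conjNormal v a = a := by
    intro v
    obtain ⟨k, hk⟩ := ha (MulAut.conjNormal v a)
    have hk : a ^ k = MulAut.conjNormal v a := hk
    have hpow : ∀ n : ℕ, MulAut.conjNormal (v ^ n) a = a ^ (k ^ n) := by
      intro n
      induction n with
      | zero => simp
      | succ n ih =>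
        rw [pow_succ' v, map_mul, MulAut.mul_apply, ih, map_zpow, ← hk, ← zpow_mul, pow_succ' k]
    have hvp : v ^ p ∈ f.ker := by
      rw [MonoidHom.mem_ker, map_pow, ← hQ, pow_card_eq_one']
    have h1 : MulAut.conjNormal (v ^ p) a = a := by
      obtain ⟨m, hm⟩ := ha ⟨v ^ p, hvp⟩
      have hm : a ^ m = ⟨v ^ p, hvp⟩ := hm
      ext
      rw [MulAut.conjNormal_apply]
      have hc := congrArg Subtype.val ((Commute.refl a).zpow_left m).eq
      rw [hm] at hc
      simp only [Subgroup.coe_mul] at hc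
      rw [hc, mul_inv_cancel_right]
    rw [hpow] at h1
    by_cases ha1 : a = 1
    · rw [ha1, map_one]
    have hinj : Function.Injective fun n : ℤ => a ^ n :=
      injective_zpow_iff_not_isOfFinOrder.2 fun h => by
        obtain ⟨n, hn, h⟩ := isOfFinOrder_iff_pow_eq_one.1 h
        exact ha1 (htf a n hn.ne' h)
    have h2 : k ^ p = 1 := hinj (by simpa using h1)
    have h3 : k = 1 := hp.strictMono_pow.injective (by simpa using h2)
    rw [← hk, h3, zpow_one]
  intro x hx
  rw [Subgroup.mem_center_iff]
  intro v
  obtain ⟨m, hm⟩ := ha ⟨x, hx⟩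
  have hm : a ^ m = ⟨x, hx⟩ := hm
  have h4 : MulAut.conjNormal v (⟨x, hx⟩ : f.ker) = ⟨x, hx⟩ := by
    rw [← hm, map_zpow, key]
  have h5 := congrArg Subtype.val h4
  rw [MulAut.conjNormal_apply] at h5
  exact mul_inv_eq_iff_eq_mul.1 h5

/-- The virtually cyclic groups among the extensions of subgroups of `ℤ/p`, with `p` odd, by
torsion-free commutative groups. -/
theorem IsVirtuallyCyclic.classification {G : Type*} [Group G] {p : ℕ} (hp : p.Prime)
    (hp2 : p ≠ 2) (f : G →* Multiplicative (ZMod p))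
    (hcomm : ∀ x ∈ f.ker, ∀ y ∈ f.ker, x * y = y * x)
    (htf : ∀ x ∈ f.ker, ∀ n : ℕ, n ≠ 0 → x ^ n = 1 → x = 1) (h : IsVirtuallyCyclic G) :
    Nonempty (G ≃* Unit) ∨ Nonempty (G ≃* Multiplicative (ZMod p)) ∨
      Nonempty (G ≃* Multiplicative ℤ) ∨
      Nonempty (G ≃* Multiplicative ℤ × Multiplicative (ZMod p)) := by
  have : Fact p.Prime := ⟨hp⟩
  have hcard : Nat.card (Multiplicative (ZMod p)) = p := Nat.card_zmod p
  have htf' : ∀ (x : f.ker) (n : ℕ), n ≠ 0 → x ^ n = 1 → x = 1 := fun x n hn hx =>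
    Subtype.ext (htf x x.2 n hn (congrArg Subtype.val hx))
  let _ : CommGroup f.ker :=
    { (inferInstance : Group f.ker) with
      mul_comm := fun x y => Subtype.ext (hcomm x x.2 y y.2) }
  have hcyc : IsCyclic f.ker := (h.subgroup f.ker).isCyclic htf'
  have hcenter := f.ker_le_center_of_isCyclic (hp.odd_of_ne_two hp2) hcard htf'
  -- The kernel is central and the quotient by it is cyclic, so `G` is commutative.
  have hG : ∀ x y : G, x * y = y * x := fun x y =>
    (f.isMulCommutative_of_isCyclic_of_ker_le_center hcenter).is_comm.comm x y
  by_cases htfG : ∀ (x : G) (n : ℕ), n ≠ 0 → x ^ n = 1 → x = 1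
  · let _ : CommGroup G := { (inferInstance : Group G) with mul_comm := hG }
    rcases nonempty_mulEquiv_unit_or_int (h.isCyclic htfG) htfG with h1 | h1
    · exact .inl h1
    · exact .inr (.inr (.inl h1))
  · push Not at htfG
    obtain ⟨w, n, hn, hwn, hw⟩ := htfG
    have hfw : f w ≠ 1 := fun hfw => hw (htf w hfw n hn hwn)
    -- `w ^ p` is a torsion element of the torsion-free kernel. Hence `w` generates a copy of `ℤ/p`
    -- that splits `f`.
    have hwp : w ^ p = 1 := by
      refine htf (w ^ p) ?_ n hn ?_
      · rw [MonoidHom.mem_ker, map_pow]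
        exact (congrArg (fun k => f w ^ k) hcard).symm.trans pow_card_eq_one'
      · rw [← pow_mul, mul_comm, pow_mul, hwn, one_pow]
    have hord : Nat.card (Subgroup.zpowers w) = p := by
      rw [Nat.card_zpowers]
      exact orderOf_eq_prime hwp hw
    let φ : f.ker × Subgroup.zpowers w →* G :=
      MonoidHom.noncommCoprod f.ker.subtype (Subgroup.zpowers w).subtype fun x y => hG x y
    have hφ : Function.Bijective φ := by
      constructor
      · refine (MonoidHom.noncommCoprod_injective _ _ _).2
          ⟨Subtype.val_injective, Subtype.val_injective, ?_⟩
        rw [Subgroup.range_subtype, Subgroup.range_subtype, Subgroup.disjoint_def]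
        intro x hx hxw
        refine htf x hx p hp.ne_zero ?_
        obtain ⟨k, rfl⟩ := hxw
        change (w ^ k) ^ p = 1
        rw [← zpow_natCast, ← zpow_mul, mul_comm, zpow_mul, zpow_natCast, hwp, one_zpow]
      · intro v
        obtain ⟨k, hk⟩ := mem_zpowers_of_prime_card hcard hfw (g' := f v)
        have hk : f w ^ k = f v := hk
        refine ⟨(⟨v * (w ^ k)⁻¹, ?_⟩, ⟨w ^ k, k, rfl⟩), inv_mul_cancel_right v (w ^ k)⟩
        rw [MonoidHom.mem_ker, map_mul, map_inv, map_zpow, hk, mul_inv_cancel]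
    let E := (MulEquiv.ofBijective φ hφ).symm
    let W : Subgroup.zpowers w ≃* Multiplicative (ZMod p) := mulEquivOfPrimeCardEq hord hcard
    rcases nonempty_mulEquiv_unit_or_int hcyc htf' with ⟨⟨h1⟩⟩ | ⟨⟨h1⟩⟩
    · exact .inr (.inl ⟨E.trans ((h1.prodCongr W).trans MulEquiv.uniqueProd)⟩)
    · exact .inr (.inr (.inr ⟨E.trans (h1.prodCongr W)⟩))

/-! ### Complements of `L`, their conjugacy classes and normalizers -/

section Semidirect

variable {G L : Type} [Group G] [AddCommGroup L] {ρ : Representation ℤ G L}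

open SemidirectProduct groupCohomology

theorem Representation.SemidirectGroup.eq_inl {x : ρ.SemidirectGroup} (hx : x.right = 1) :
    x = inl (Multiplicative.ofAdd x.left.toAdd) :=
  SemidirectProduct.ext rfl hx

theorem Representation.SemidirectGroup.inl_conj (l : L) (x : ρ.SemidirectGroup) :
    inl (Multiplicative.ofAdd l) * x * (inl (Multiplicative.ofAdd l))⁻¹ =
      ⟨Multiplicative.ofAdd (l + x.left.toAdd - ρ x.right l), x.right⟩ := by
  rw [← map_inv, ← ofAdd_neg]
  refine SemidirectProduct.ext ?_ ?_
  · rw [mul_left, mul_left, mul_right, left_inl, left_inl, right_inl, one_mul, map_one]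
    change Multiplicative.ofAdd (l + x.left.toAdd + ρ x.right (-l)) = _
    rw [map_neg, sub_eq_add_neg]
  · simp

theorem Representation.SemidirectGroup.commute_of_right_eq_one {x y : ρ.SemidirectGroup}
    (hx : x.right = 1) (hy : y.right = 1) : x * y = y * x := by
  rw [eq_inl hx, eq_inl hy, ← map_mul, mul_comm, map_mul]

theorem Representation.SemidirectGroup.eq_one_of_pow_eq_one
    (htf : ∀ (x : L) (n : ℕ), n ≠ 0 → n • x = 0 → x = 0) {x : ρ.SemidirectGroup}
    (hx : x.right = 1) {n : ℕ} (hn : n ≠ 0) (h : x ^ n = 1) : x = 1 := by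
  rw [eq_inl hx, ← map_pow, ← map_one (inl : Multiplicative L →* ρ.SemidirectGroup)] at h
  have h2 := inl_injective h
  have h1 : x.left.toAdd = 0 := htf _ n hn (congrArg Multiplicative.toAdd h2)
  rw [eq_inl hx, h1, ofAdd_zero, map_one]

/-- `x * y⁻¹` is a torsion element of `L`. This is the injectivity of the projection to `G` on
finite subgroups. -/
theorem Representation.SemidirectGroup.eq_of_right_eq
    (htf : ∀ (x : L) (n : ℕ), n ≠ 0 → n • x = 0 → x = 0) {H : Subgroup ρ.SemidirectGroup}
    [Finite H] {x y : ρ.SemidirectGroup} (hx : x ∈ H) (hy : y ∈ H) (h : x.right = y.right) :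
    x = y := by
  rw [← mul_inv_eq_one]
  refine eq_one_of_pow_eq_one htf (n := Nat.card H) ?_ Nat.card_pos.ne' ?_
  · rw [mul_right, inv_right, h, mul_inv_cancel]
  · have : (⟨x * y⁻¹, H.mul_mem hx (H.inv_mem hy)⟩ : H) ^ Nat.card H = 1 := pow_card_eq_one'
    exact congrArg Subtype.val this

theorem mem_cocycleSubgroup {f : cocycles₁ (Rep.of ρ)} {x : ρ.SemidirectGroup} :
    x ∈ cocycleSubgroup ρ f ↔ x.left = Multiplicative.ofAdd (f x.right : L) :=
  Iff.rfl

theorem cocycleSubgroup.finite [Finite G] (f : cocycles₁ (Rep.of ρ)) :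
    Finite (cocycleSubgroup ρ f) :=
  Finite.of_injective (fun x : cocycleSubgroup ρ f => x.1.right) fun x y h => by
    refine Subtype.ext (SemidirectProduct.ext ?_ h)
    have hx := mem_cocycleSubgroup.1 x.2
    rw [show x.1.right = y.1.right from h] at hx
    exact hx.trans (mem_cocycleSubgroup.1 y.2).symm

theorem cocycleSubgroup.isMaximalFinite [Finite G]
    (htf : ∀ (x : L) (n : ℕ), n ≠ 0 → n • x = 0 → x = 0) (f : cocycles₁ (Rep.of ρ)) :
    IsMaximalFinite (cocycleSubgroup ρ f) := by
  refine ⟨cocycleSubgroup.finite f, fun K hK hle x hx => ?_⟩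
  have hK : Finite K := hK
  let y : ρ.SemidirectGroup := ⟨Multiplicative.ofAdd (f x.right : L), x.right⟩
  have hy : y ∈ cocycleSubgroup ρ f := mem_cocycleSubgroup.2 rfl
  rwa [Representation.SemidirectGroup.eq_of_right_eq htf hx (hle hy) rfl]

/-- A finite subgroup that maps onto `G` comes from a cocycle. -/
theorem exists_eq_cocycleSubgroup
    (htf : ∀ (x : L) (n : ℕ), n ≠ 0 → n • x = 0 → x = 0) (H : Subgroup ρ.SemidirectGroup)
    [Finite H] (hH : ∀ g : G, ∃ x ∈ H, x.right = g) :
    ∃ f : cocycles₁ (Rep.of ρ), H = cocycleSubgroup ρ f := by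
  choose s hs hsr using hH
  have hmul : ∀ g h, s (g * h) = s g * s h := fun g h =>
    Representation.SemidirectGroup.eq_of_right_eq htf (hs _) (H.mul_mem (hs g) (hs h))
      (by rw [mul_right, hsr, hsr, hsr])
  refine ⟨⟨fun g => (s g).left.toAdd, ?_⟩, ?_⟩
  · rw [mem_cocycles₁_iff]
    intro g h
    rw [hmul, mul_left, hsr]
    exact add_comm _ _
  · ext x
    rw [mem_cocycleSubgroup]
    constructor
    · intro hx
      have := Representation.SemidirectGroup.eq_of_right_eq htf hx (hs x.right) (hsr _).symm
      exact congrArg SemidirectProduct.left this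
    · intro hx
      have : x = s x.right := SemidirectProduct.ext hx (hsr _).symm
      rw [this]
      exact hs _

/-- Conjugation by `l` in `L` replaces `f g` by `f g + l - ρ g l`. An arbitrary `γ` reduces to this
case: write `γ = l * k` with `k` the element of the complement above `γ.right`; conjugation by `k`
preserves the complement. -/
theorem H1π_eq_iff_exists_conj (f f' : cocycles₁ (Rep.of ρ)) :
    H1π (Rep.of ρ) f = H1π (Rep.of ρ) f' ↔ ∃ γ : ρ.SemidirectGroup,
      cocycleSubgroup ρ f' = (cocycleSubgroup ρ f).map (MulAut.conj γ).toMonoidHom := by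
  rw [H1π_eq_iff]
  constructor
  · rintro ⟨l, hl⟩
    have hl : ∀ g, ρ g l - l = (f g : L) - f' g := fun g => congrFun hl g
    refine ⟨inl (Multiplicative.ofAdd l), ?_⟩
    ext x
    rw [mem_cocycleSubgroup, Subgroup.mem_map]
    simp only [MulEquiv.coe_toMonoidHom, MulAut.conj_apply,
      Representation.SemidirectGroup.inl_conj, mem_cocycleSubgroup]
    have aux : ∀ w x y z : L, w - x = y - z → x + y - w = z := fun w x y z h => by
      rw [sub_eq_sub_iff_add_eq_add] at h
      rw [sub_eq_iff_eq_add, add_comm x, ← h, add_comm]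
    have key : ∀ g, l + (f g : L) - ρ g l = f' g := fun g => aux _ _ _ _ (hl g)
    constructor
    · intro hx
      refine ⟨⟨Multiplicative.ofAdd (f x.right : L), x.right⟩, rfl, ?_⟩
      exact SemidirectProduct.ext ((congrArg Multiplicative.ofAdd (key x.right)).trans hx.symm) rfl
    · rintro ⟨y, hy, rfl⟩
      change Multiplicative.ofAdd (l + y.left.toAdd - ρ y.right l) = _
      rw [hy]
      exact congrArg Multiplicative.ofAdd (key y.right)
  · rintro ⟨γ, hγ⟩
    let k : ρ.SemidirectGroup := ⟨Multiplicative.ofAdd (f γ.right : L), γ.right⟩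
    have hk : k ∈ cocycleSubgroup ρ f := mem_cocycleSubgroup.2 rfl
    have hm : (γ * k⁻¹).right = 1 := by
      rw [mul_right, inv_right, mul_inv_cancel]
    set l : L := (γ * k⁻¹).left.toAdd with hl
    have key : ∀ g, l + (f g : L) - ρ g l = f' g := fun g => by
      let y : ρ.SemidirectGroup := ⟨Multiplicative.ofAdd (f g : L), g⟩
      have hy : y ∈ cocycleSubgroup ρ f := mem_cocycleSubgroup.2 rfl
      have h1 : (γ * k⁻¹) * y * (γ * k⁻¹)⁻¹ ∈ cocycleSubgroup ρ f' := by
        rw [hγ, Subgroup.mem_map]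
        refine ⟨k⁻¹ * y * k, Subgroup.mul_mem _ (Subgroup.mul_mem _ (Subgroup.inv_mem _ hk) hy) hk,
          ?_⟩
        simp only [MulEquiv.coe_toMonoidHom, MulAut.conj_apply]
        group
      rw [Representation.SemidirectGroup.eq_inl hm, Representation.SemidirectGroup.inl_conj,
        mem_cocycleSubgroup] at h1
      exact h1
    refine ⟨l, funext fun g => ?_⟩
    change ρ g l - l = (f g : L) - f' g
    rw [← key g]
    abel

/-- The classes of complements are the classes of maximal finite subgroups. -/
theorem exists_H1_equiv_maximalFiniteClasses [Finite G]
    (htf : ∀ (x : L) (n : ℕ), n ≠ 0 → n • x = 0 → x = 0) (hG : (Nat.card G).Prime) :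
    ∃ e : H1 (Rep.of ρ) ≃ MaximalFiniteClasses ρ.SemidirectGroup,
      ∀ f : cocycles₁ (Rep.of ρ), ∃ hf : IsMaximalFinite (cocycleSubgroup ρ f),
        e (H1π (Rep.of ρ) f) =
          Quotient.mk (maximalFiniteSetoid ρ.SemidirectGroup) ⟨cocycleSubgroup ρ f, hf⟩ := by
  have hsurj : ∀ x : H1 (Rep.of ρ), ∃ f, H1π (Rep.of ρ) f = x := fun x =>
    H1_induction_on x fun f => ⟨f, rfl⟩
  choose r hr using hsurj
  let cls : cocycles₁ (Rep.of ρ) → MaximalFiniteClasses ρ.SemidirectGroup := fun f =>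
    Quotient.mk (maximalFiniteSetoid ρ.SemidirectGroup)
      ⟨cocycleSubgroup ρ f, cocycleSubgroup.isMaximalFinite htf f⟩
  have hcls : ∀ f f', cls f = cls f' ↔ H1π (Rep.of ρ) f = H1π (Rep.of ρ) f' := fun f f' =>
    (Quotient.eq (r := maximalFiniteSetoid ρ.SemidirectGroup)).trans
      (H1π_eq_iff_exists_conj f f').symm
  have hbij : Function.Bijective fun x => cls (r x) := by
    constructor
    · intro x y hxy
      rw [← hr x, ← hr y]
      exact (hcls _ _).1 hxy
    · intro c
      induction c using Quotient.inductionOn with | _ H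
      obtain ⟨H, hH⟩ := H
      have hfin : Finite H := hH.1
      have hprime : Fact (Nat.card G).Prime := ⟨hG⟩
      have hH' : ∀ g : G, ∃ x ∈ H, x.right = g := by
        -- If the image is trivial, so is `H`; it then lies strictly inside the complement given by
        -- the zero cocycle, against maximality.
        rcases (H.map rightHom).eq_bot_or_eq_top_of_prime_card with h | h
        · exfalso
          have hbot : H = ⊥ := by
            rw [eq_bot_iff]
            intro x hx
            have hx1 : x.right = 1 :=
              Subgroup.mem_bot.1 (h ▸ Subgroup.mem_map_of_mem rightHom hx)
            exact Subgroup.mem_bot.2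
              (Representation.SemidirectGroup.eq_of_right_eq htf hx H.one_mem hx1)
          have hle : cocycleSubgroup ρ 0 ≤ H :=
            hH.2 (cocycleSubgroup.finite 0) (hbot ▸ bot_le)
          rw [hbot] at hle
          have : Nontrivial G := Finite.one_lt_card_iff_nontrivial.1 hG.one_lt
          obtain ⟨g, hg⟩ := exists_ne (1 : G)
          have hmem : (⟨1, g⟩ : ρ.SemidirectGroup) ∈ cocycleSubgroup ρ 0 :=
            mem_cocycleSubgroup.2 rfl
          exact hg (congrArg SemidirectProduct.right (Subgroup.mem_bot.1 (hle hmem)))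
        · intro g
          exact Subgroup.mem_map.1 (h ▸ Subgroup.mem_top g : g ∈ H.map rightHom)
      obtain ⟨f, rfl⟩ := exists_eq_cocycleSubgroup htf H hH'
      exact ⟨H1π (Rep.of ρ) f, (hcls _ _).2 (hr _)⟩
  exact ⟨Equiv.ofBijective _ hbij, fun f =>
    ⟨cocycleSubgroup.isMaximalFinite htf f, (hcls _ _).2 (hr _)⟩⟩

/-- The normalizer of a complement `P` of `L` in `L ⋊ G` is the product of `P` and the
invariants of `L`. -/
theorem exists_normalizer_equiv (P : Subgroup ρ.SemidirectGroup)
    (hinj : ∀ x ∈ P, ∀ y ∈ P, x.right = y.right → x = y) (hsurj : ∀ g : G, ∃ x ∈ P, x.right = g) :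
    ∃ e : Subgroup.normalizer (P : Set ρ.SemidirectGroup) ≃*
        Multiplicative ρ.invariants × P,
      ∀ x, (e x).1 = 1 ↔ x ∈ P.subgroupOf (Subgroup.normalizer (P : Set ρ.SemidirectGroup)) := by
  have hcomm : ∀ (l : ρ.invariants) (q : ρ.SemidirectGroup),
      inl (Multiplicative.ofAdd (l : L)) * q * (inl (Multiplicative.ofAdd (l : L)))⁻¹ = q := by
    intro l q
    rw [Representation.SemidirectGroup.inl_conj, l.2 q.right, add_sub_cancel_left]
    rfl
  let ι : Multiplicative ρ.invariants →* Subgroup.normalizer (P : Set ρ.SemidirectGroup) :=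
    ((inl : Multiplicative L →* ρ.SemidirectGroup).comp
      ρ.invariants.subtype.toAddMonoidHom.toMultiplicative).codRestrict _ fun l => by
        rw [Subgroup.mem_normalizer_iff]
        intro q
        exact iff_of_eq (congrArg (· ∈ P) (hcomm l.toAdd q).symm)
  have hι : ∀ l, (ι l : ρ.SemidirectGroup) = inl (Multiplicative.ofAdd (l.toAdd : L)) :=
    fun l => rfl
  let κ : P →* Subgroup.normalizer (P : Set ρ.SemidirectGroup) :=
    Subgroup.inclusion Subgroup.le_normalizer
  let φ : Multiplicative ρ.invariants × P →* Subgroup.normalizer (P : Set ρ.SemidirectGroup) :=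
    MonoidHom.noncommCoprod ι κ fun l q =>
      Subtype.ext (mul_inv_eq_iff_eq_mul.1 (hcomm l.toAdd q))
  have hφ : ∀ l q, (φ (l, q) : ρ.SemidirectGroup) = ι l * q := fun l q => rfl
  have hιP : ∀ l, (ι l : ρ.SemidirectGroup) ∈ P → l = 1 := fun l hl => by
    have h1 := hinj _ hl 1 P.one_mem rfl
    have h2 : (Multiplicative.ofAdd (l.toAdd : L)) = 1 :=
      inl_injective ((hι l).symm.trans (h1.trans (map_one _).symm))
    exact congrArg Multiplicative.ofAdd (Subtype.ext h2 : l.toAdd = 0)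
  have hbij : Function.Bijective φ := by
    constructor
    · rw [injective_iff_map_eq_one]
      rintro ⟨l, q⟩ h
      have h1 : (ι l : ρ.SemidirectGroup) * q = 1 := congrArg Subtype.val h
      have h2 : l = 1 := hιP l (by rw [eq_inv_of_mul_eq_one_left h1]; exact P.inv_mem q.2)
      rw [h2, map_one] at h1
      exact Prod.ext h2 (Subtype.ext ((one_mul _).symm.trans h1))
    · intro n
      obtain ⟨q, hq, hqn⟩ := hsurj n.1.right
      have hm : (n.1 * q⁻¹).right = 1 := by rw [mul_right, inv_right, hqn, mul_inv_cancel]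
      have hmN := Subgroup.mem_normalizer_iff.1 (Subgroup.mul_mem _ n.2
        (Subgroup.inv_mem _ (Subgroup.le_normalizer hq)))
      set l : L := (n.1 * q⁻¹).left.toAdd
      -- Conjugation by `l` preserves `P` and the `G`-component, hence fixes `P` pointwise; this
      -- says that `l` is invariant.
      have hl : l ∈ ρ.invariants := fun g => by
        obtain ⟨s, hs, rfl⟩ := hsurj g
        have h1 := (hmN s).1 hs
        rw [Representation.SemidirectGroup.eq_inl hm, Representation.SemidirectGroup.inl_conj] at h1
        have h2 : l + s.left.toAdd - ρ s.right l = s.left.toAdd :=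
          congrArg SemidirectProduct.left (hinj _ h1 s hs rfl)
        rw [add_sub_right_comm, add_eq_right, sub_eq_zero] at h2
        exact h2.symm
      refine ⟨(Multiplicative.ofAdd ⟨l, hl⟩, ⟨q, hq⟩), Subtype.ext ?_⟩
      rw [hφ, hι]
      exact (congrArg (· * q) (Representation.SemidirectGroup.eq_inl hm).symm).trans
        (inv_mul_cancel_right _ _)
  refine ⟨(MulEquiv.ofBijective φ hbij).symm, fun x => ?_⟩
  obtain ⟨⟨l, q⟩, rfl⟩ := hbij.2 x
  have h1 : (MulEquiv.ofBijective φ hbij).symm (φ (l, q)) = (l, q) :=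
    (MulEquiv.ofBijective φ hbij).symm_apply_apply (l, q)
  rw [h1, Subgroup.mem_subgroupOf, hφ, Subgroup.mul_mem_cancel_right P q.2]
  refine ⟨fun h => ?_, hιP l⟩
  rw [show l = 1 from h, map_one]
  exact P.one_mem

theorem nonempty_normalizer_equiv (htf : ∀ (x : L) (n : ℕ), n ≠ 0 → n • x = 0 → x = 0)
    [Finite G] (P : Subgroup ρ.SemidirectGroup) (hP : Nat.card P = Nat.card G)
    {M : Type*} [AddCommGroup M] (e : ρ.invariants ≃+ M) :
    Nonempty (Subgroup.normalizer (P : Set ρ.SemidirectGroup) ≃* Multiplicative M × P) ∧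
      Nonempty (Subgroup.normalizer (P : Set ρ.SemidirectGroup) ⧸
        P.subgroupOf (Subgroup.normalizer (P : Set ρ.SemidirectGroup)) ≃* Multiplicative M) := by
  have hfin : Finite P := Nat.finite_of_card_ne_zero (hP ▸ Nat.card_pos.ne')
  have hinj : ∀ x ∈ P, ∀ y ∈ P, x.right = y.right → x = y := fun x hx y hy h =>
    Representation.SemidirectGroup.eq_of_right_eq htf hx hy h
  have hbij : Function.Bijective fun x : P => x.1.right :=
    (Nat.bijective_iff_injective_and_card _).2
      ⟨fun x y h => Subtype.ext (hinj x x.2 y y.2 h), hP⟩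
  obtain ⟨E, hE⟩ := exists_normalizer_equiv P hinj fun g => by
    obtain ⟨x, hx⟩ := hbij.2 g
    exact ⟨x, x.2, hx⟩
  refine ⟨⟨E.trans (e.toMultiplicative.prodCongr (MulEquiv.refl P))⟩, ?_⟩
  let π : Subgroup.normalizer (P : Set ρ.SemidirectGroup) →* Multiplicative ρ.invariants :=
    (MonoidHom.fst _ _).comp E.toMonoidHom
  have hπ : Function.Surjective π := Prod.fst_surjective.comp E.surjective
  have hker : P.subgroupOf (Subgroup.normalizer (P : Set ρ.SemidirectGroup)) = π.ker := by
    ext x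
    exact (hE x).symm
  exact ⟨(QuotientGroup.quotientMulEquivOfEq hker).trans
    ((QuotientGroup.quotientKerEquivOfSurjective π hπ).trans e.toMultiplicative)⟩

end Semidirect

/-! ### Invariants and first cohomology for modules of type `(a, b, c)` -/

section CyclicModule

open groupCohomology SemidirectProduct

variable {p : ℕ} {L : Type} [AddCommGroup L] {ρ : Representation ℤ (Multiplicative (ZMod p)) L}

theorem Multiplicative.zmod_induction [NeZero p] {P : Multiplicative (ZMod p) → Prop} (h1 : P 1)
    (hmul : ∀ g, P g → P (Multiplicative.ofAdd 1 * g)) (g : Multiplicative (ZMod p)) : P g := by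
  have h : ∀ n : ℕ, P (Multiplicative.ofAdd (n : ZMod p)) := by
    intro n
    induction n with
    | zero => simpa using h1
    | succ n ih =>
      have := hmul _ ih
      rwa [← ofAdd_add, add_comm, ← Nat.cast_succ] at this
  have h2 := h (ZMod.val g.toAdd)
  rwa [ZMod.natCast_zmod_val] at h2

theorem Representation.mem_invariants_of_generator [NeZero p] {l : L}
    (hl : ρ (Multiplicative.ofAdd 1) l = l) : l ∈ ρ.invariants := fun g => by
  induction g using Multiplicative.zmod_induction with
  | h1 => simp
  | hmul g hg => rw [map_mul, Module.End.mul_apply, hg, hl]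

theorem groupCohomology.cocycles₁_apply_mul (f : cocycles₁ (Rep.of ρ))
    (g h : Multiplicative (ZMod p)) : (f (g * h) : L) = ρ g (f h) + f g :=
  (mem_cocycles₁_iff f.1).1 f.2 g h

theorem groupCohomology.cocycles₁_eq_zero_of_generator [NeZero p] (f : cocycles₁ (Rep.of ρ))
    (hf : (f (Multiplicative.ofAdd 1) : L) = 0) : f = 0 := by
  refine cocycles₁_ext fun g => ?_
  change (f g : L) = 0
  induction g using Multiplicative.zmod_induction with
  | h1 => exact cocycles₁_map_one f
  | hmul g hg => rw [cocycles₁_apply_mul, hg, hf, map_zero, zero_add]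

theorem groupCohomology.mem_coboundaries₁_iff_generator [NeZero p] (f : cocycles₁ (Rep.of ρ)) :
    ⇑f ∈ coboundaries₁ (Rep.of ρ) ↔
      ∃ l : L, ρ (Multiplicative.ofAdd 1) l - l = f (Multiplicative.ofAdd 1) := by
  constructor
  · rintro ⟨l, hl⟩
    exact ⟨l, congrFun hl (Multiplicative.ofAdd 1)⟩
  · rintro ⟨l, hl⟩
    let d : cocycles₁ (Rep.of ρ) := ⟨d₀₁ (Rep.of ρ) l, d₀₁_apply_mem_cocycles₁ (A := Rep.of ρ) l⟩
    have h : f - d = 0 := cocycles₁_eq_zero_of_generator _ (sub_eq_zero.2 hl.symm)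
    rw [sub_eq_zero.1 h]
    exact ⟨l, rfl⟩

/-- Invariant integral functionals vanish on cocycles of a finite cyclic group. -/
theorem groupCohomology.map_cocycles₁_eq_zero [NeZero p] (f : cocycles₁ (Rep.of ρ)) (φ : L →+ ℤ)
    (hφ : ∀ x, φ (ρ (Multiplicative.ofAdd 1) x) = φ x) :
    φ (f (Multiplicative.ofAdd 1) : L) = 0 := by
  -- By invariance `φ ∘ f` is additive along powers of the generator; taking `n = p` gives `p * φ (f
  -- t) = φ (f 1) = 0` in `ℤ`.
  have h : ∀ n : ℕ, φ (f (Multiplicative.ofAdd (n : ZMod p)) : L) =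
      n * φ (f (Multiplicative.ofAdd 1) : L) := by
    intro n
    induction n with
    | zero =>
      rw [Nat.cast_zero, ofAdd_zero]
      have h1 : (f 1 : L) = 0 := cocycles₁_map_one f
      rw [h1]
      simp
    | succ n ih =>
      rw [Nat.cast_succ, add_comm, ofAdd_add, cocycles₁_apply_mul, map_add, hφ, ih]
      push_cast
      ring
  have h2 := h p
  rw [ZMod.natCast_self, ofAdd_zero] at h2
  have h1 : (f 1 : L) = 0 := cocycles₁_map_one f
  rw [h1, map_zero] at h2
  exact (mul_eq_zero.1 h2.symm).resolve_left (Nat.cast_ne_zero.2 (NeZero.ne p))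

/-- The powers of `(x, t)` form a finite subgroup mapping onto `ℤ/p`, hence the graph of a cocycle.
-/
theorem groupCohomology.exists_cocycles₁_of_pow_eq_one [NeZero p]
    (htf : ∀ (x : L) (n : ℕ), n ≠ 0 → n • x = 0 → x = 0) (x : L)
    (hx : (⟨Multiplicative.ofAdd x, Multiplicative.ofAdd 1⟩ : ρ.SemidirectGroup) ^ p = 1) :
    ∃ f : cocycles₁ (Rep.of ρ), (f (Multiplicative.ofAdd 1) : L) = x := by
  set γ : ρ.SemidirectGroup := ⟨Multiplicative.ofAdd x, Multiplicative.ofAdd 1⟩ with hγ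
  have hfin : Finite (Subgroup.zpowers γ) :=
    isOfFinOrder_iff_pow_eq_one.2 ⟨p, Nat.pos_of_ne_zero (NeZero.ne p), hx⟩ |>.finite_zpowers
  obtain ⟨f, hf⟩ := exists_eq_cocycleSubgroup htf (Subgroup.zpowers γ) fun g => by
    induction g using Multiplicative.zmod_induction with
    | h1 => exact ⟨1, Subgroup.one_mem _, rfl⟩
    | hmul g hg =>
      obtain ⟨y, hy, rfl⟩ := hg
      exact ⟨γ * y, Subgroup.mul_mem _ (Subgroup.mem_zpowers γ) hy, rfl⟩
  have h1 : γ ∈ cocycleSubgroup ρ f := hf ▸ Subgroup.mem_zpowers γ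
  exact ⟨f, (congrArg Multiplicative.toAdd (mem_cocycleSubgroup.1 h1)).symm⟩

variable {a b c : ℕ} {R : Type*} [CommRing R] {ζ : R}
  {M : Fin a → Type*} [∀ i, AddCommGroup (M i)] [∀ i, Module R (M i)]
  {N : Fin b → Type*} [∀ j, AddCommGroup (N j)] [∀ j, Module R (N j)]
  {u : ∀ j, N j} (e : L ≃+ (∀ i, M i) × (∀ j, N j × ℤ) × (Fin c → ℤ))

/-- A pair `(x, m)` in `N j × ℤ` is fixed iff `(1 - ζ) • x = m • u j`. This forces `p ∣ m`, and `m`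
determines `x`; with `p = (1 - ζ) * w`, the fixed pairs are the multiples of `(w • u j, p)`. -/
theorem nonempty_invariants_equiv (hp : p.Prime) (hdvd : 1 - ζ ∣ (p : R))
    (hM : ∀ i (x : M i), (1 - ζ) • x = 0 → x = 0) (hN : ∀ j (x : N j), (1 - ζ) • x = 0 → x = 0)
    (hu : ∀ j (x : N j), u j ≠ (1 - ζ) • x)
    (he : ∀ x : L, e (ρ (Multiplicative.ofAdd 1) x) =
      (fun i => ζ • (e x).1 i,
        fun j => (ζ • ((e x).2.1 j).1 + ((e x).2.1 j).2 • u j, ((e x).2.1 j).2), (e x).2.2)) :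
    Nonempty (ρ.invariants ≃+ (Fin (b + c) → ℤ)) := by
  have : NeZero p := ⟨hp.ne_zero⟩
  obtain ⟨w, hw⟩ := hdvd
  have hwu : ∀ j, (1 - ζ) • (w • u j) = (p : ℤ) • u j := fun j => by
    rw [smul_smul, ← hw, Nat.cast_smul_eq_nsmul, natCast_zsmul]
  let φ : (Fin b → ℤ) × (Fin c → ℤ) →+ ρ.invariants :=
    AddMonoidHom.mk' (fun n => ⟨e.symm (0, fun j => (n.1 j • w • u j, n.1 j * p), n.2), by
      refine Representation.mem_invariants_of_generator (e.injective ?_)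
      rw [he, e.apply_symm_apply]
      refine Prod.ext (funext fun i => smul_zero _) (Prod.ext (funext fun j => Prod.ext ?_ rfl) rfl)
      change ζ • n.1 j • w • u j + (n.1 j * p) • u j = n.1 j • w • u j
      rw [mul_smul, ← hwu, sub_smul, one_smul, smul_sub, smul_comm ζ (n.1 j), add_sub_cancel]⟩)
      fun m n => Subtype.ext <| e.injective <| by
        rw [Submodule.coe_add, map_add, e.apply_symm_apply, e.apply_symm_apply, e.apply_symm_apply]
        refine Prod.ext (add_zero _).symm (Prod.ext (funext fun j => Prod.ext ?_ ?_) rfl)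
        · exact add_smul _ _ _
        · exact add_mul _ _ _
  have hφ : ∀ n, e (φ n : L) = (0, fun j => (n.1 j • w • u j, n.1 j * p), n.2) := fun n =>
    e.apply_symm_apply _
  have hbij : Function.Bijective φ := by
    constructor
    · rw [injective_iff_map_eq_zero]
      intro n hn
      have h1 := hφ n
      rw [hn, Submodule.coe_zero, map_zero] at h1
      refine Prod.ext (funext fun j => ?_) (congrArg (fun x => x.2.2) h1).symm
      have h2 : 0 = n.1 j * (p : ℤ) := congrArg (fun x => (x.2.1 j).2) h1
      exact (mul_eq_zero.1 h2.symm).resolve_right (Nat.cast_ne_zero.2 hp.ne_zero)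
    · rintro ⟨l, hl⟩
      have h1 := he l
      rw [hl (Multiplicative.ofAdd 1)] at h1
      have hB : ∀ i, (e l).1 i = 0 := fun i => hM i _ <| by
        have h2 : (e l).1 i = ζ • (e l).1 i := congrArg (fun x => x.1 i) h1
        rw [sub_smul, one_smul, ← h2, sub_self]
      have hC : ∀ j, (1 - ζ) • ((e l).2.1 j).1 = ((e l).2.1 j).2 • u j := fun j => by
        have h2 : ((e l).2.1 j).1 = ζ • ((e l).2.1 j).1 + ((e l).2.1 j).2 • u j :=
          congrArg (fun x => (x.2.1 j).1) h1
        rw [sub_smul, one_smul]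
        exact sub_eq_of_eq_add' h2
      have hdvd : ∀ j, (p : ℤ) ∣ ((e l).2.1 j).2 := fun j => by
        by_contra hnd
        -- Bézout for `p` and `m`: both `p • u j` and `m • u j` lie in `(1 - ζ) N j`, so `u j` would
        -- too.
        obtain ⟨r, s, hrs⟩ :=
          (Int.prime_iff_natAbs_prime.2 (by simpa using hp) : Prime (p : ℤ)).coprime_iff_not_dvd.2 hnd
        refine hu j (r • w • u j + s • ((e l).2.1 j).1) ?_
        rw [smul_add, smul_comm _ r, smul_comm _ s, hwu, hC, ← mul_smul, ← mul_smul, ← add_smul,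
          hrs, one_smul]
      choose n hn using hdvd
      refine ⟨(n, (e l).2.2), Subtype.ext (e.injective ?_)⟩
      rw [hφ]
      refine Prod.ext (funext fun i => (hB i).symm)
        (Prod.ext (funext fun j => Prod.ext ?_ ((mul_comm _ _).trans (hn j).symm)) rfl)
      refine sub_eq_zero.1 (hN j _ ?_)
      change (1 - ζ) • (n j • w • u j - ((e l).2.1 j).1) = 0
      rw [smul_sub, hC, smul_comm _ (n j), hwu, ← mul_smul, hn j, mul_comm, sub_self]
  exact ⟨((AddEquiv.ofBijective φ hbij).symm.trans
    (LinearEquiv.sumArrowLequivProdArrow (Fin b) (Fin c) ℤ ℤ).symm.toAddEquiv).trans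
    (LinearEquiv.funCongrLeft ℤ ℤ finSumFinEquiv.symm).toAddEquiv⟩

/-- The isomorphism takes the `M i`-components of `f t` modulo `1 - ζ`. The other components carry
no cohomology: the integer ones vanish, and the `N j`-component is a coboundary because `u j` spans
`N j` modulo `1 - ζ`. -/
theorem nonempty_H1_equiv (hp : p.Prime) (hζ : ∑ k ∈ Finset.range p, ζ ^ k = 0)
    (htf : ∀ (x : L) (n : ℕ), n ≠ 0 → n • x = 0 → x = 0)
    (qM : ∀ i, M i →+ ZMod p) (hqM : ∀ i, Function.Surjective (qM i))
    (hqM0 : ∀ i x, qM i x = 0 ↔ ∃ y, x = (1 - ζ) • y)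
    (qN : ∀ j, N j →+ ZMod p) (hqN0 : ∀ j x, qN j x = 0 ↔ ∃ y, x = (1 - ζ) • y)
    (hu : ∀ j (x : N j), u j ≠ (1 - ζ) • x)
    (he : ∀ x : L, e (ρ (Multiplicative.ofAdd 1) x) =
      (fun i => ζ • (e x).1 i,
        fun j => (ζ • ((e x).2.1 j).1 + ((e x).2.1 j).2 • u j, ((e x).2.1 j).2), (e x).2.2)) :
    Nonempty (H1 (Rep.of ρ) ≃+ (Fin a → ZMod p)) := by
  have : Fact p.Prime := ⟨hp⟩
  let ψ : cocycles₁ (Rep.of ρ) →+ (Fin a → ZMod p) :=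
    AddMonoidHom.mk' (fun f i => qM i ((e (f (Multiplicative.ofAdd 1) : L)).1 i)) fun f g => by
      funext i
      change qM i ((e ((f (Multiplicative.ofAdd 1) : L) + (g (Multiplicative.ofAdd 1) : L))).1 i) =
        _
      rw [map_add]
      exact map_add (qM i) _ _
  have hψ : ∀ f i, ψ f i = qM i ((e (f (Multiplicative.ofAdd 1) : L)).1 i) := fun f i => rfl
  have hsurj : Function.Surjective ψ := by
    intro z
    choose v hv using fun i => hqM i (z i)
    -- The `L`-part of the `n`-th power is a partial norm; at `n = p` it vanishes because `∑ ζ ^ k =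
    -- 0`.
    have hpow : ∀ n : ℕ, (⟨Multiplicative.ofAdd (e.symm (v, 0, 0)), Multiplicative.ofAdd 1⟩ :
        ρ.SemidirectGroup) ^ n =
        ⟨Multiplicative.ofAdd (e.symm (fun i => (∑ k ∈ Finset.range n, ζ ^ k) • v i, 0, 0)),
          Multiplicative.ofAdd (n : ZMod p)⟩ := by
      intro n
      induction n with
      | zero =>
        rw [pow_zero]
        refine SemidirectProduct.ext (congrArg Multiplicative.ofAdd (e.injective ?_)) ?_
        · change e 0 = _
          rw [map_zero, e.apply_symm_apply]
          simp
          rfl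
        · simp
      | succ n ih =>
        rw [pow_succ', ih]
        refine SemidirectProduct.ext (congrArg Multiplicative.ofAdd (e.injective ?_)) ?_
        · change e (e.symm (v, 0, 0) + ρ (Multiplicative.ofAdd 1) (e.symm _)) = _
          rw [map_add, he, e.apply_symm_apply, e.apply_symm_apply, e.apply_symm_apply]
          refine Prod.ext (funext fun i => ?_) (Prod.ext (funext fun j => Prod.ext ?_ ?_) ?_)
          · change v i + ζ • (∑ k ∈ Finset.range n, ζ ^ k) • v i = _ • v i
            rw [Finset.sum_range_succ', ← mul_smul, Finset.mul_sum, pow_zero, add_smul, one_smul,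
              add_comm]
            simp only [pow_succ']
          · change 0 + (ζ • (0 : N j) + (0 : ℤ) • u j) = 0
            simp
          · exact add_zero 0
          · exact add_zero 0
        · change Multiplicative.ofAdd (1 : ZMod p) * Multiplicative.ofAdd (n : ZMod p) = _
          rw [← ofAdd_add, add_comm, Nat.cast_succ]
    obtain ⟨f, hf⟩ := exists_cocycles₁_of_pow_eq_one (ρ := ρ) htf (e.symm (v, 0, 0)) <| by
      rw [hpow, hζ]
      refine SemidirectProduct.ext (congrArg Multiplicative.ofAdd (e.injective ?_)) ?_
      · change _ = e 0
        rw [map_zero, e.apply_symm_apply]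
        simp
        rfl
      · simp
    refine ⟨f, funext fun i => ?_⟩
    rw [hψ, hf, e.apply_symm_apply, hv]
  have hker : ∀ f, ψ f = 0 ↔ ⇑f ∈ coboundaries₁ (Rep.of ρ) := by
    intro f
    rw [mem_coboundaries₁_iff_generator]
    constructor
    · intro hf
      have hf' : ∀ i, ∃ y, (e (f (Multiplicative.ofAdd 1) : L)).1 i = (1 - ζ) • y := fun i =>
        (hqM0 i _).1 (congrFun hf i)
      choose v hv using hf'
      have hy : ∀ j, ∃ (n : ℤ) (y : N j),
          ((e (f (Multiplicative.ofAdd 1) : L)).2.1 j).1 - n • u j = (1 - ζ) • y := fun j => by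
        have huj : qN j (u j) ≠ 0 := fun h => by
          obtain ⟨y, hy⟩ := (hqN0 j _).1 h
          exact hu j y hy
        obtain ⟨n, hn⟩ := ZMod.intCast_surjective
          (qN j ((e (f (Multiplicative.ofAdd 1) : L)).2.1 j).1 / qN j (u j))
        refine ⟨n, (hqN0 j _).1 ?_⟩
        rw [map_sub, map_zsmul, zsmul_eq_mul, hn, div_mul_cancel₀ _ huj, sub_self]
      choose n y hy using hy
      have h1 : ∀ j, ((e (f (Multiplicative.ofAdd 1) : L)).2.1 j).2 = 0 := fun j =>
        map_cocycles₁_eq_zero f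
          (AddMonoidHom.mk' (fun x => ((e x).2.1 j).2) fun x y => by rw [map_add]; rfl)
          fun x => by
            change ((e (ρ _ x)).2.1 j).2 = ((e x).2.1 j).2
            rw [he]
      have h2 : ∀ k, (e (f (Multiplicative.ofAdd 1) : L)).2.2 k = 0 := fun k =>
        map_cocycles₁_eq_zero f
          (AddMonoidHom.mk' (fun x => (e x).2.2 k) fun x y => by rw [map_add]; rfl)
          fun x => by
            change (e (ρ _ x)).2.2 k = (e x).2.2 k
            rw [he]
      -- The signs come from `t - 1` acting as `-(1 - ζ)`; the integer coordinate `n j` supplies the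
      -- multiple of `u j`.
      refine ⟨e.symm (fun i => - v i, fun j => (- y j, n j), 0), e.injective ?_⟩
      rw [map_sub, he, e.apply_symm_apply]
      refine Prod.ext (funext fun i => ?_) (Prod.ext (funext fun j => Prod.ext ?_ ?_)
        (funext fun k => ?_))
      · change ζ • (- v i) - (- v i) = _
        rw [hv, sub_smul, one_smul, smul_neg]
        abel
      · change ζ • (- y j) + n j • u j - (- y j) = _
        rw [sub_eq_iff_eq_add.1 (hy j), sub_smul, one_smul, smul_neg]
        abel
      · exact (sub_self (n j)).trans (h1 j).symm
      · exact (sub_self (0 : ℤ)).trans (h2 k).symm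
    · rintro ⟨l, hl⟩
      funext i
      rw [hψ, ← hl, map_sub, he]
      refine (hqM0 i _).2 ⟨- (e l).1 i, ?_⟩
      change ζ • (e l).1 i - (e l).1 i = _
      rw [smul_neg, sub_smul, one_smul, neg_sub]
  let π : cocycles₁ (Rep.of ρ) →+ H1 (Rep.of ρ) := (H1π (Rep.of ρ)).hom.toAddMonoidHom
  have hπ : Function.Surjective π := fun x => H1_induction_on x fun f => ⟨f, rfl⟩
  have hk : π.ker = ψ.ker := by
    ext f
    rw [AddMonoidHom.mem_ker, AddMonoidHom.mem_ker, hker]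
    exact H1π_eq_zero_iff f
  exact ⟨((QuotientAddGroup.quotientKerEquivOfSurjective π hπ).symm.trans
    (QuotientAddGroup.quotientAddEquivOfEq hk)).trans
    (QuotientAddGroup.quotientKerEquivOfSurjective ψ hsurj)⟩

end CyclicModule

/-! ### Assembly of the theorem -/

theorem mainTheorem11 {p : ℕ} (hp : p.Prime) {K : Type*} [Field K] [NumberField K]
    [IsCyclotomicExtension {p} ℚ K] (ζ : 𝓞 K) (hζ : IsPrimitiveRoot ζ p) (a b c : ℕ)
    {L : Type} [AddCommGroup L] (ρ : Representation ℤ (Multiplicative (ZMod p)) L)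
    (hρ : IsOfType ζ a b c ρ) :
    (p ≠ 2 → ∀ V : Subgroup ρ.SemidirectGroup, IsVirtuallyCyclic V →
      Nonempty (V ≃* Unit) ∨
      Nonempty (V ≃* Multiplicative (ZMod p)) ∨
      Nonempty (V ≃* Multiplicative ℤ) ∨
      Nonempty (V ≃* Multiplicative ℤ × Multiplicative (ZMod p))) ∧
    Nat.card (MaximalFiniteClasses ρ.SemidirectGroup) = p ^ a ∧
    (∃ e : groupCohomology.H1 (Rep.of ρ) ≃ MaximalFiniteClasses ρ.SemidirectGroup,
      ∀ f : groupCohomology.cocycles₁ (Rep.of ρ),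
        ∃ hf : IsMaximalFinite (cocycleSubgroup ρ f),
          e (groupCohomology.H1π (Rep.of ρ) f) =
            Quotient.mk (maximalFiniteSetoid ρ.SemidirectGroup) ⟨cocycleSubgroup ρ f, hf⟩) ∧
    Nonempty (groupCohomology.H1 (Rep.of ρ) ≃+ (Fin a → ZMod p)) ∧
    (∀ P : Subgroup ρ.SemidirectGroup, Nat.card P = p →
      Nonempty (Subgroup.normalizer (P : Set ρ.SemidirectGroup) ≃*
        Multiplicative (Fin (b + c) → ℤ) × P) ∧
      Nonempty (Subgroup.normalizer (P : Set ρ.SemidirectGroup) ⧸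
          P.subgroupOf (Subgroup.normalizer (P : Set ρ.SemidirectGroup)) ≃*
        Multiplicative (Fin (b + c) → ℤ))) := by
  have : Fact p.Prime := ⟨hp⟩
  obtain ⟨B, C, u, hB, hC, hu, e, he⟩ := hρ
  have hsub : (1 - ζ : 𝓞 K) ≠ 0 := fun h => hζ.ne_one hp.one_lt (sub_eq_zero.1 h).symm
  have hI0 : ∀ (I : FractionalIdeal (𝓞 K)⁰ K) (x : ↥(I : Submodule (𝓞 K) K)),
      (1 - ζ) • x = 0 → x = 0 := fun I x hx => (smul_eq_zero.1 hx).resolve_left hsub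
  have hItf : ∀ (I : FractionalIdeal (𝓞 K)⁰ K) (x : ↥(I : Submodule (𝓞 K) K)) (n : ℕ),
      n ≠ 0 → n • x = 0 → x = 0 := fun I x n hn hx => by
    refine Subtype.ext ((smul_eq_zero.1 (?_ : n • (x : K) = 0)).resolve_left hn)
    exact congrArg Subtype.val hx
  have htf : ∀ (x : L) (n : ℕ), n ≠ 0 → n • x = 0 → x = 0 := fun x n hn hx => by
    have h1 : n • e x = 0 := by rw [← map_nsmul, hx, map_zero]
    refine e.injective (Eq.trans ?_ (map_zero e).symm)
    refine Prod.ext (funext fun i => ?_) (Prod.ext (funext fun j => Prod.ext ?_ ?_)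
      (funext fun k => ?_))
    · exact hItf _ _ n hn (congrArg (fun y => y.1 i) h1)
    · exact hItf _ _ n hn (congrArg (fun y => (y.2.1 j).1) h1)
    · exact (smul_eq_zero.1 (congrArg (fun y => (y.2.1 j).2) h1 : n • ((e x).2.1 j).2 = 0))
        |>.resolve_left hn
    · exact (smul_eq_zero.1 (congrArg (fun y => y.2.2 k) h1 : n • (e x).2.2 k = 0))
        |>.resolve_left hn
  choose qB hqB hqB0 using fun i => (B i).exists_addMonoidHom_zmod hp hζ (hB i)
  choose qC _ hqC0 using fun j => (C j).exists_addMonoidHom_zmod hp hζ (hC j)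
  have hH1 : Nonempty (groupCohomology.H1 (Rep.of ρ) ≃+ (Fin a → ZMod p)) :=
    nonempty_H1_equiv e hp (hζ.geom_sum_eq_zero hp.one_lt) htf qB hqB hqB0 qC hqC0 hu he
  have hcard : Nat.card (Multiplicative (ZMod p)) = p := Nat.card_zmod p
  obtain ⟨E, hE⟩ := exists_H1_equiv_maximalFiniteClasses (ρ := ρ) htf (hcard.symm ▸ hp)
  refine ⟨fun hp2 V hV => ?_, ?_, ⟨E, hE⟩, hH1, fun P hP => ?_⟩
  · refine hV.classification hp hp2 (SemidirectProduct.rightHom.comp V.subtype) ?_ ?_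
    · exact fun x hx y hy =>
        Subtype.ext (Representation.SemidirectGroup.commute_of_right_eq_one hx hy)
    · exact fun x hx n hn h => Subtype.ext
        (Representation.SemidirectGroup.eq_one_of_pow_eq_one htf hx hn (congrArg Subtype.val h))
  · rw [← Nat.card_congr E, Nat.card_congr hH1.some.toEquiv]
    simp
  · obtain ⟨F⟩ := nonempty_invariants_equiv e hp (hζ.one_sub_dvd_natCast hp.one_lt)
      (fun i => hI0 (B i)) (fun j => hI0 (C j)) hu he
    exact nonempty_normalizer_equiv htf P (hP.trans hcard.symm) F
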